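/- Let $\eta = 3+2\sqrt2$ and $\eta' = 4\eta-1$, and for integers $k\ge 0$ put $$S_k = -(1+k)^2(1+2k)^2(4k-1)(4k+7),\quad T_k = -2(4k+5)(6k^2+15k+8),\quad U_k = 3(4k+3)(4k+5)(4k+7),$$ $$S'_k = -16(1+k)^2(1+2k)^2(4k-1)(4k+7),\quad T'_k = -(4k+5),\quad U'_k = 3(4k+3)(4k+5)(4k+7).$$ For real sequences $a,b$ write $\mathop{\mathrm K}_{k\ge0}\frac{a_k}{b_k}$ for the continued fraction $\cfrac{a_0}{b_0+\cfrac{a_1}{b_1+\cdots}}$, understood as the limit of its convergents; the $n$-th convergent ($n\ge0$) uses the pairs $(a_k,b_k)$ with $k<n$. Then both continued fractions below converge, all their convergents have non-zero denominators, and $$\ln 2 = \cfrac{6\eta}{-2+9\eta-\mathop{\mathrm K}_{k\ge0}\dfrac{S_k}{T_k+\eta U_k}} = \cfrac{6+6\eta'}{1+9\eta'-\mathop{\mathrm K}_{k\ge0}\dfrac{S'_k}{T'_k+\eta' U'_k}}.$$ The two forms are equivalent: let $x_n$ and $x'_n$ be obtained from the first and the second expression by replacing the infinite fraction by its $n$-th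 convergent; then the outer denominators of $x_n$ and $x'_n$ are non-zero and $x_n=x'_n$ for every $n\ge0$. The rate of convergence is $\rho^{-2n}$ with $\rho = 33+24\sqrt2+4\sqrt{140+99\sqrt2}$, that is, there are constants $0<c\le C$ such that $$c\,\rho^{-2n}\le|\ln 2-x_n|\le C\,\rho^{-2n}\qquad\text{for all sufficiently large } n,$$ and likewise for $x'_n$. Numerically $\rho^{-2n}\approx 10^{-4.25n}$; precisely, $|2\log_{10}\rho-4.25|<0.005$. -/

import Mathlib

open Filter Topology Asymptotics

namespace LogTwoCF

noncomputable section

/-- Gauss's `K_{k ≥ 0} a k / b k`, i.e. `a 0 / (b 0 + a 1 / (b 1 + a 2 / (b 2 + ⋯)))`, as a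
generalised continued fraction with head term `0`. Its `n`-th convergent `(K a b).convs n` is
`a 0 / (b 0 + ⋯ + a (n - 1) / b (n - 1))`, using the first `n` pairs, and is the quotient
`(K a b).nums n / (K a b).dens n`. -/
def K (a b : ℕ → ℝ) : GenContFract ℝ where
  h := 0
  s := Stream'.Seq.ofStream (fun k : ℕ => GenContFract.Pair.mk (a k) (b k))

/-- The infinite continued fraction `K_{k ≥ 0} a k / b k` converges to `L`: its convergents
are all well defined (no convergent has denominator zero) and tend to `L`. -/
def ConvergesTo (a b : ℕ → ℝ) (L : ℝ) : Prop :=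
  (∀ n, (K a b).dens n ≠ 0) ∧ Tendsto (fun n => (K a b).convs n) atTop (𝓝 L)

/-- `η = 3 + 2√2`. -/
def eta : ℝ := 3 + 2 * √2

/-- `S_k`. -/
def S (k : ℕ) : ℝ :=
  -((1 + (k : ℝ)) ^ 2 * (1 + 2 * (k : ℝ)) ^ 2 * (4 * (k : ℝ) - 1) * (4 * (k : ℝ) + 7))

/-- `T_k`. -/
def T (k : ℕ) : ℝ := -2 * (4 * (k : ℝ) + 5) * (6 * (k : ℝ) ^ 2 + 15 * (k : ℝ) + 8)

/-- `U_k`. -/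
def U (k : ℕ) : ℝ := 3 * (4 * (k : ℝ) + 3) * (4 * (k : ℝ) + 5) * (4 * (k : ℝ) + 7)

/-- `η' = 4η - 1`. -/
def eta' : ℝ := 4 * eta - 1

/-- `S'_k`. -/
def S' (k : ℕ) : ℝ :=
  -(16 * (1 + (k : ℝ)) ^ 2 * (1 + 2 * (k : ℝ)) ^ 2 * (4 * (k : ℝ) - 1) * (4 * (k : ℝ) + 7))

/-- `T'_k`. -/
def T' (k : ℕ) : ℝ := -(4 * (k : ℝ) + 5)

/-- `U'_k`. -/
def U' (k : ℕ) : ℝ := 3 * (4 * (k : ℝ) + 3) * (4 * (k : ℝ) + 5) * (4 * (k : ℝ) + 7)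

/-- The continued fraction `K_{k ≥ 0} S_k / (T_k + η U_k)`. -/
def K₁ : GenContFract ℝ := K S (fun k => T k + eta * U k)

/-- The continued fraction `K_{k ≥ 0} S'_k / (T'_k + η' U'_k)`. -/
def K₂ : GenContFract ℝ := K S' (fun k => T' k + eta' * U' k)

/-- The `n`-th approximant of the first expansion: the tail is replaced by its
`n`-th convergent. -/
def approx₁ (n : ℕ) : ℝ := 6 * eta / (-2 + 9 * eta - K₁.convs n)

/-- The `n`-th approximant of the second expansion. -/
def approx₂ (n : ℕ) : ℝ := (6 + 6 * eta') / (1 + 9 * eta' - K₂.convs n)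

/-- `33 + 24√2 + 4√(140 + 99√2)`; the approximants converge at the rate `rho ^ (-2 n)`. -/
def rho : ℝ := 33 + 24 * √2 + 4 * √(140 + 99 * √2)

end

end LogTwoCF

/-!
The two expansions of `log 2` are continued fractions of a Legendre function of the second kind,
read off at every second step.

Let `P n` be the Legendre polynomials and `Q n x = ∫ t in -1..1, P n t / (x - t)`. For `1 < x` both
`P · x` and `Q · x` solve the three-term recurrence `SolvesLegendre x`, the second one because
`∫ t in -1..1, P n t = 0` for `1 ≤ n`. Since `(eta + 1) / (eta - 1) = √2`, one has
`log 2 = 2 * Q 0 eta` (`log_two_eq`). The combination `W n = Q 0 x * P n x - Q n x` is the solution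
with initial values `0, 2`, and the quotients `W n / P n` are the classical Padé approximants at
infinity of `Q 0 x = log ((x + 1) / (x - 1))`.

Eliminating the terms of odd index from the recurrence gives one that relates `y n`, `y (n + 2)` and
`y (n + 4)` and involves only `x ^ 2` (`SolvesLegendre.even_contraction`). As
`eta ^ 2 = 6 * eta - 1`, at `x = eta` it is, up to the scaling `evenScale`, the recurrence with
coefficients `S k` and `T k + eta * U k` (`evenScale_mul_eq`). Comparing initial values gives
`approx₁ n = 2 * W (2 * n + 2) / P (2 * n + 2)`, so that
`log 2 - approx₁ n = 2 * Q (2 * n + 2) / P (2 * n + 2)` (`log_two_sub_approx₁`).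

For the rate put `e n = Q n / P n`. It tends to `0`, since `|Q n| ≤ C * 3 ^ n` and `4 ^ n ≤ P n`, and
the Casoratian gives `e n - e (n + 1) = 2 / ((n + 1) * P n * P (n + 1))`. Writing
`2 * x = l + l⁻¹`, the sharp growth `P n ≍ 4⁻ⁿ * centralBinom n * l ^ n` (`SolvesLegendre.bounds`) and
Wallis' bounds (`centralCoeff_mul_bounds`) yield `e n ≍ l ^ (-2 * n)` (`legendreQ_div_bounds`);
at `x = eta` one has `l ^ 2 = rho`.

The second expansion is the first one with the partial numerators multiplied by `4 ^ 2` and the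
partial denominators by `4` (`nums_dens_K₂`).
-/

namespace LogTwoCF

/-! ### Legendre polynomials -/

open Polynomial in
/-- The Legendre polynomials, normalised by the value `1` at `1` and defined by Bonnet's
recurrence. -/
noncomputable def legendre : ℕ → ℝ[X]
  | 0 => 1
  | 1 => X
  | n + 2 => C ((2 * (n : ℝ) + 3) / (n + 2)) * X * legendre (n + 1)
      - C (((n : ℝ) + 1) / (n + 2)) * legendre n

/-- The sequence `y` solves the three-term recurrence of the Legendre polynomials at `x`. -/
def SolvesLegendre (x : ℝ) (y : ℕ → ℝ) : Prop :=
  ∀ n : ℕ, ((n : ℝ) + 2) * y (n + 2) = (2 * n + 3) * x * y (n + 1) - (n + 1) * y n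

lemma solvesLegendre_eval_legendre (x : ℝ) : SolvesLegendre x fun n => (legendre n).eval x := by
  intro n
  have h : (n : ℝ) + 2 ≠ 0 := by positivity
  simp only [legendre, Polynomial.eval_sub, Polynomial.eval_mul, Polynomial.eval_C,
    Polynomial.eval_X]
  field_simp

lemma eval_derivative_legendre_rec (n : ℕ) (x : ℝ) :
    ((n : ℝ) + 2) * (legendre (n + 2)).derivative.eval x
      = (2 * n + 3) * ((legendre (n + 1)).eval x + x * (legendre (n + 1)).derivative.eval x)
        - (n + 1) * (legendre n).derivative.eval x := by
  have h : (n : ℝ) + 2 ≠ 0 := by positivity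
  simp only [legendre, Polynomial.derivative_sub, Polynomial.derivative_mul,
    Polynomial.derivative_C, Polynomial.derivative_X, Polynomial.eval_sub, Polynomial.eval_add,
    Polynomial.eval_mul, Polynomial.eval_C, Polynomial.eval_X, Polynomial.eval_zero,
    Polynomial.eval_one]
  field_simp
  ring

/-- Two classical identities for the derivative; the induction step for each of them uses both. -/
lemma eval_derivative_legendre_succ (x : ℝ) (n : ℕ) :
    (legendre (n + 1)).derivative.eval x
        = x * (legendre n).derivative.eval x + (n + 1) * (legendre n).eval x ∧
      x * (legendre (n + 1)).derivative.eval x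
        = (n + 1) * (legendre (n + 1)).eval x + (legendre n).derivative.eval x := by
  induction n with
  | zero => simp [legendre]
  | succ n ih =>
    obtain ⟨hA, hB⟩ := ih
    have hn : (n : ℝ) + 2 ≠ 0 := by positivity
    have hrec := solvesLegendre_eval_legendre x n
    have hder := eval_derivative_legendre_rec n x
    have h1 : (legendre (n + 2)).derivative.eval x
        = x * (legendre (n + 1)).derivative.eval x + (n + 2) * (legendre (n + 1)).eval x := by
      apply mul_left_cancel₀ hn
      linear_combination hder + (n + 1) * hB
    push_cast
    refine ⟨by linear_combination h1, ?_⟩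
    linear_combination x * h1 + x * hB - hA - hrec

lemma eval_one_legendre (n : ℕ) : (legendre n).eval 1 = 1 := by
  induction n using Nat.twoStepInduction with
  | zero => simp [legendre]
  | one => simp [legendre]
  | more n h0 h1 =>
    have h := solvesLegendre_eval_legendre 1 n
    have hn : (n : ℝ) + 2 ≠ 0 := by positivity
    simp only [h0, h1] at h
    apply mul_left_cancel₀ hn
    linear_combination h

lemma eval_neg_one_legendre (n : ℕ) : (legendre n).eval (-1) = (-1) ^ n := by
  induction n using Nat.twoStepInduction with
  | zero => simp [legendre]
  | one => simp [legendre]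
  | more n h0 h1 =>
    have h := solvesLegendre_eval_legendre (-1) n
    have hn : (n : ℝ) + 2 ≠ 0 := by positivity
    simp only [h0, h1] at h
    apply mul_left_cancel₀ hn
    linear_combination h

/-- Orthogonality to constants: `(t * P (n + 1) - P n) / (n + 2)` is an antiderivative of `P (n + 1)`
and vanishes at both end points. -/
lemma integral_legendre_succ (n : ℕ) : ∫ t in (-1 : ℝ)..1, (legendre (n + 1)).eval t = 0 := by
  have hn : (n : ℝ) + 2 ≠ 0 := by positivity
  have hderiv : ∀ t ∈ Set.uIcc (-1 : ℝ) 1,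
      HasDerivAt (fun t => (t * (legendre (n + 1)).eval t - (legendre n).eval t) / (n + 2))
        ((legendre (n + 1)).eval t) t := by
    intro t _
    have h := (((hasDerivAt_id t).mul ((legendre (n + 1)).hasDerivAt t)).sub
      ((legendre n).hasDerivAt t)).div_const ((n : ℝ) + 2)
    refine h.congr_deriv ?_
    rw [div_eq_iff hn]
    simp only [id]
    linear_combination (eval_derivative_legendre_succ t n).2
  rw [intervalIntegral.integral_eq_sub_of_hasDerivAt hderiv
    ((legendre (n + 1)).continuous.intervalIntegrable _ _)]
  simp only [eval_one_legendre, eval_neg_one_legendre, pow_succ]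
  ring

/-- The sharp bound is `1`; all that matters later is that `3` is less than the growth rate of the
polynomials at `eta`. -/
lemma abs_eval_legendre_le {t : ℝ} (ht : |t| ≤ 1) (n : ℕ) : |(legendre n).eval t| ≤ 3 ^ n := by
  induction n using Nat.twoStepInduction with
  | zero => simp [legendre]
  | one => simpa [legendre] using ht.trans (by norm_num)
  | more n h0 h1 =>
    have h := solvesLegendre_eval_legendre t n
    have hn : (0 : ℝ) < (n : ℝ) + 2 := by positivity
    refine le_of_mul_le_mul_left ?_ hn
    rw [← abs_of_pos hn, ← abs_mul, h, abs_of_pos hn]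
    refine (abs_sub _ _).trans ?_
    rw [abs_mul, abs_mul, abs_mul, abs_of_pos (by positivity : (0 : ℝ) < 2 * n + 3),
      abs_of_pos (by positivity : (0 : ℝ) < n + 1)]
    have h2 : |t| * |(legendre (n + 1)).eval t| ≤ 1 * 3 ^ (n + 1) := by gcongr
    have h3 : (0 : ℝ) < 3 ^ n := by positivity
    rw [pow_succ] at h1 h2
    rw [pow_add]
    nlinarith [mul_nonneg (Nat.cast_nonneg (α := ℝ) n) h3.le,
      mul_le_mul_of_nonneg_left h2 (by positivity : (0 : ℝ) ≤ 2 * n + 3),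
      mul_le_mul_of_nonneg_left h0 (by positivity : (0 : ℝ) ≤ n + 1)]

/-! ### Legendre functions of the second kind -/

/-- Twice the Legendre function of the second kind, by Neumann's integral; meant for `1 < x`. -/
noncomputable def legendreQ (x : ℝ) (n : ℕ) : ℝ :=
  ∫ t in (-1 : ℝ)..1, (legendre n).eval t / (x - t)

section

variable {x : ℝ}

lemma sub_pos_of_mem_uIcc (hx : 1 < x) {t : ℝ} (ht : t ∈ Set.uIcc (-1 : ℝ) 1) : 0 < x - t := by
  rw [Set.uIcc_of_le (by norm_num)] at ht
  linarith [ht.2]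

lemma intervalIntegrable_div_sub (hx : 1 < x) (p : Polynomial ℝ) :
    IntervalIntegrable (fun t => p.eval t / (x - t)) MeasureTheory.volume (-1) 1 := by
  apply ContinuousOn.intervalIntegrable
  exact p.continuous.continuousOn.div (by fun_prop) fun t ht => (sub_pos_of_mem_uIcc hx ht).ne'

lemma legendreQ_zero (hx : 1 < x) : legendreQ x 0 = Real.log ((x + 1) / (x - 1)) := by
  have hderiv : ∀ t ∈ Set.uIcc (-1 : ℝ) 1,
      HasDerivAt (fun t => -Real.log (x - t)) ((legendre 0).eval t / (x - t)) t := by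
    intro t ht
    have h := (((hasDerivAt_id t).const_sub x).log (sub_pos_of_mem_uIcc hx ht).ne').neg
    refine h.congr_deriv ?_
    simp [legendre, neg_div]
  rw [legendreQ, intervalIntegral.integral_eq_sub_of_hasDerivAt hderiv
    (intervalIntegrable_div_sub hx _), Real.log_div (by linarith) (by linarith)]
  ring_nf

/-- Obtained from `t / (x - t) = x / (x - t) - 1`. -/
lemma integral_mul_legendre_div_sub (hx : 1 < x) (n : ℕ) :
    ∫ t in (-1 : ℝ)..1, (Polynomial.X * legendre n).eval t / (x - t)
      = x * legendreQ x n - ∫ t in (-1 : ℝ)..1, (legendre n).eval t := by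
  rw [legendreQ, ← intervalIntegral.integral_const_mul, ← intervalIntegral.integral_sub
    ((intervalIntegrable_div_sub hx _).const_mul x)
    ((legendre n).continuous.intervalIntegrable _ _)]
  refine intervalIntegral.integral_congr fun t ht => ?_
  have := (sub_pos_of_mem_uIcc hx ht).ne'
  simp only [Polynomial.eval_mul, Polynomial.eval_X]
  field_simp
  ring

lemma legendreQ_one (hx : 1 < x) : legendreQ x 1 = x * legendreQ x 0 - 2 := by
  have h := integral_mul_legendre_div_sub hx 0
  have h2 : ∫ t in (-1 : ℝ)..1, (legendre 0).eval t = 2 := by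
    simp [legendre]; norm_num
  rw [h2] at h
  rw [← h, legendreQ]
  simp [legendre]

lemma solvesLegendre_legendreQ (hx : 1 < x) : SolvesLegendre x (legendreQ x) := by
  intro n
  have h := integral_mul_legendre_div_sub hx (n + 1)
  rw [integral_legendre_succ, sub_zero] at h
  have h2 : (2 * (n : ℝ) + 3) * x * legendreQ x (n + 1)
      = (2 * n + 3) * (x * legendreQ x (n + 1)) := by ring
  rw [h2, ← h]
  simp only [legendreQ]
  rw [← intervalIntegral.integral_const_mul, ← intervalIntegral.integral_const_mul,
    ← intervalIntegral.integral_const_mul, ← intervalIntegral.integral_sub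
    ((intervalIntegrable_div_sub hx _).const_mul _)
    ((intervalIntegrable_div_sub hx _).const_mul _)]
  refine intervalIntegral.integral_congr fun t ht => ?_
  have := (sub_pos_of_mem_uIcc hx ht).ne'
  have hr := solvesLegendre_eval_legendre t n
  simp only [Polynomial.eval_mul, Polynomial.eval_X]
  field_simp
  linear_combination hr

lemma abs_legendreQ_le (hx : 1 < x) (n : ℕ) : |legendreQ x n| ≤ 2 / (x - 1) * 3 ^ n := by
  have h : ∀ t ∈ Set.uIoc (-1 : ℝ) 1, ‖(legendre n).eval t / (x - t)‖ ≤ 3 ^ n / (x - 1) := by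
    intro t ht
    rw [Set.uIoc_of_le (by norm_num)] at ht
    have h1 : 0 < x - 1 := by linarith
    have h2 : x - 1 ≤ x - t := by linarith [ht.2]
    rw [Real.norm_eq_abs, abs_div, abs_of_pos (h1.trans_le h2)]
    gcongr
    exact abs_eval_legendre_le (abs_le.2 ⟨ht.1.le, ht.2⟩) n
  have := intervalIntegral.norm_integral_le_of_norm_le_const h
  rw [Real.norm_eq_abs] at this
  refine this.trans_eq ?_
  norm_num
  ring

/-! ### Solutions of the Legendre recurrence -/

lemma SolvesLegendre.linear_comb {y z : ℕ → ℝ} (hy : SolvesLegendre x y) (hz : SolvesLegendre x z)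
    (a b : ℝ) : SolvesLegendre x fun n => a * y n + b * z n := by
  intro n
  linear_combination a * hy n + b * hz n

/-- The Casoratian of two solutions is a constant divided by `n + 1`. -/
lemma SolvesLegendre.casoratian {y z : ℕ → ℝ} (hy : SolvesLegendre x y) (hz : SolvesLegendre x z)
    (n : ℕ) : ((n : ℝ) + 1) * (z n * y (n + 1) - z (n + 1) * y n) = z 0 * y 1 - z 1 * y 0 := by
  induction n with
  | zero => simp
  | succ n ih =>
    push_cast
    linear_combination ih + z (n + 1) * hy n - y (n + 1) * hz n

lemma SolvesLegendre.le_succ_and_nonneg {y : ℕ → ℝ} (hx : 1 < x) (hy : SolvesLegendre x y)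
    (h0 : 0 ≤ y 0) (h1 : y 0 ≤ y 1) (n : ℕ) : 0 ≤ y n ∧ y n ≤ y (n + 1) := by
  induction n with
  | zero => exact ⟨h0, h1⟩
  | succ n ih =>
    have hn : (0 : ℝ) < (n : ℝ) + 2 := by positivity
    have hnn : 0 ≤ y (n + 1) := ih.1.trans ih.2
    refine ⟨hnn, le_of_mul_le_mul_left ?_ hn⟩
    have h := hy n
    have e1 : 0 ≤ (2 * (n : ℝ) + 3) * (x - 1) * y (n + 1) :=
      mul_nonneg (mul_nonneg (by positivity) (by linarith)) hnn
    have e2 : 0 ≤ ((n : ℝ) + 1) * (y (n + 1) - y n) :=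
      mul_nonneg (by positivity) (by linarith [ih.2])
    show ((n : ℝ) + 2) * y (n + 1) ≤ ((n : ℝ) + 2) * y (n + 2)
    linarith

lemma SolvesLegendre.mul_pow_le {y : ℕ → ℝ} (hx : 5 ≤ x) (hy : SolvesLegendre x y)
    (h0 : 0 ≤ y 0) (h1 : y 0 ≤ y 1) (n : ℕ) : y 1 * 4 ^ n ≤ y (n + 1) := by
  induction n with
  | zero => simp
  | succ n ih =>
    have hn : (0 : ℝ) < (n : ℝ) + 2 := by positivity
    obtain ⟨hn0, hn1⟩ := hy.le_succ_and_nonneg (by linarith) h0 h1 n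
    have h := hy n
    have h2 : ((n : ℝ) + 2) * (4 * y (n + 1)) ≤ ((n : ℝ) + 2) * y (n + 2) := by
      have e1 : 0 ≤ (2 * (n : ℝ) + 3) * (x - 5) * y (n + 1) :=
        mul_nonneg (mul_nonneg (by positivity) (by linarith)) (hn0.trans hn1)
      have e2 : 0 ≤ ((n : ℝ) + 1) * (y (n + 1) - y n) :=
        mul_nonneg (by positivity) (by linarith)
      have e3 : 0 ≤ (n : ℝ) * y (n + 1) := mul_nonneg (by positivity) (hn0.trans hn1)
      nlinarith [hn0.trans hn1]
    have h3 := le_of_mul_le_mul_left h2 hn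
    show y 1 * 4 ^ (n + 1) ≤ y (n + 2)
    rw [pow_succ]
    linarith

end

/-! ### Growth of the Legendre polynomials -/

/-- The coefficient `centralBinom n / 4 ^ n` of `t ^ n` in `(1 - t) ^ (-1 / 2)`. -/
noncomputable def centralCoeff (n : ℕ) : ℝ := Nat.centralBinom n / 4 ^ n

lemma centralCoeff_pos (n : ℕ) : 0 < centralCoeff n :=
  div_pos (by exact_mod_cast Nat.centralBinom_pos n) (by positivity)

lemma succ_mul_centralCoeff_succ (n : ℕ) :
    2 * ((n : ℝ) + 1) * centralCoeff (n + 1) = (2 * n + 1) * centralCoeff n := by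
  have h : ((n : ℝ) + 1) * (n + 1).centralBinom = 2 * (2 * n + 1) * n.centralBinom := by
    exact_mod_cast Nat.succ_mul_centralBinom_succ n
  have h4 : (4 : ℝ) ^ n ≠ 0 := by positivity
  rw [centralCoeff, centralCoeff, pow_succ]
  field_simp
  linear_combination 2 * h

/-- Bounds of Wallis type: the middle quantity decreases, and its quotient by the lower bound
increases. -/
lemma centralCoeff_mul_bounds (n : ℕ) :
    ((n : ℝ) + 1) / (2 * (2 * n + 1)) ≤ (n + 1) * (centralCoeff n * centralCoeff (n + 1)) ∧
      (n + 1) * (centralCoeff n * centralCoeff (n + 1)) ≤ 1 / 2 := by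
  induction n with
  | zero => norm_num [centralCoeff, Nat.centralBinom]
  | succ n ih =>
    obtain ⟨hl, hu⟩ := ih
    have h0 := succ_mul_centralCoeff_succ n
    have h1 := succ_mul_centralCoeff_succ (n + 1)
    push_cast at h1 ⊢
    set u := ((n : ℝ) + 1) * (centralCoeff n * centralCoeff (n + 1)) with hu_def
    have hstep : ((n : ℝ) + 1 + 1) * (centralCoeff (n + 1) * centralCoeff (n + 1 + 1))
        = u * (((2 * n + 1) * (2 * n + 3)) / (4 * (n + 1) ^ 2)) := by
      rw [hu_def, mul_div_assoc', eq_div_iff (by positivity)]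
      linear_combination 2 * ((n : ℝ) + 1) ^ 2 * centralCoeff (n + 1) * h1
        + (n + 1) * (2 * n + 3) * centralCoeff (n + 1) * h0
    have hle : ((2 * (n : ℝ) + 1) * (2 * n + 3)) / (4 * (n + 1) ^ 2) ≤ 1 := by
      rw [div_le_one (by positivity)]
      nlinarith
    rw [hstep]
    constructor
    · refine le_trans ?_ (mul_le_mul_of_nonneg_right hl (by positivity))
      rw [div_mul_div_comm, div_le_div_iff₀ (by positivity) (by positivity)]
      have : (0 : ℝ) ≤ n := Nat.cast_nonneg n
      have key : 0 ≤ ((n : ℝ) + 1) * (2 * n + 1) * ((2 * n + 3) ^ 2 - 4 * (n + 1) * (n + 2)) := by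
        have : (0 : ℝ) ≤ (2 * n + 3) ^ 2 - 4 * (n + 1) * (n + 2) := by ring_nf; norm_num
        positivity
      nlinarith
    · exact (mul_le_of_le_one_right ((by positivity : (0 : ℝ) ≤ _).trans hl) hle).trans hu

section

variable {x l : ℝ} {p : ℕ → ℝ}

/-- Bounds for the ratio of a Legendre polynomial to its leading asymptotics. The recurrence telescopes
to `r (n + 1) = 1 + q * r n - q * ∑ j < n, r j / ((2 * j + 1) * (2 * j + 3))`, and the coefficients in
the sum add up to at most `1 / 2`. -/
lemma ratio_bounds {q : ℝ} (hq0 : 0 ≤ q) (hq : q ≤ 1 / 2) {r : ℕ → ℝ} (h0 : r 0 = 1)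
    (h1 : r 1 = 1 + q)
    (hr : ∀ n : ℕ, r (n + 2) - r (n + 1)
      = q * (r (n + 1) - r n) - q * r n / ((2 * n + 1) * (2 * n + 3))) (n : ℕ) :
    1 / 2 ≤ r n ∧ r n ≤ 2 := by
  -- `1 + q * r n - r (n + 1)` is `q` times the sum; the bound `r j ≤ 2` turns the sum of the
  -- coefficients into the telescoping `1 - 1 / (2 * n + 1)`.
  have key : ∀ n : ℕ, (1 / 2 ≤ r n ∧ r n ≤ 2) ∧ 0 ≤ 1 + q * r n - r (n + 1) ∧
      1 + q * r n - r (n + 1) ≤ q * (1 - 1 / (2 * n + 1)) := by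
    intro n
    induction n with
    | zero => rw [h0, zero_add, h1]; norm_num
    | succ n ih =>
      obtain ⟨⟨hl, hu⟩, hs0, hs1⟩ := ih
      have hn : (0 : ℝ) ≤ n := Nat.cast_nonneg n
      have hinv : (0 : ℝ) ≤ 1 / (2 * n + 1) := by positivity
      have hql : q * (1 / 2) ≤ q * r n := by gcongr
      have hqu : q * r n ≤ q * 2 := by gcongr
      have hqi : 0 ≤ q * (1 / (2 * n + 1)) := by positivity
      have hstep : 1 + q * r (n + 1) - r (n + 1 + 1)
          = (1 + q * r n - r (n + 1)) + q * r n / ((2 * n + 1) * (2 * n + 3)) := by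
        linear_combination -(hr n)
      have hpos : 0 ≤ q * r n / ((2 * n + 1) * (2 * n + 3)) :=
        div_nonneg (mul_nonneg hq0 (by linarith)) (by positivity)
      have hle : q * r n / ((2 * n + 1) * (2 * n + 3))
          ≤ q * (1 / (2 * n + 1) - 1 / (2 * n + 3)) := by
        have : q * (1 / (2 * (n : ℝ) + 1) - 1 / (2 * n + 3))
            = q * 2 / ((2 * n + 1) * (2 * n + 3)) := by
          field_simp
          ring
        rw [this]
        gcongr
      refine ⟨⟨by linarith, by linarith⟩, by linarith, ?_⟩
      rw [hstep]
      push_cast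
      have : (2 * ((n : ℝ) + 1) + 1) = 2 * n + 3 := by ring
      rw [this]
      linarith
  exact (key n).1

/-- The growth of the Legendre polynomials outside `[-1, 1]` up to a constant factor, in terms of `l`
with `2 * x = l + l⁻¹`. -/
lemma SolvesLegendre.bounds (hl0 : 0 < l) (hl : 2 ≤ l ^ 2) (hlx : 2 * x * l = l ^ 2 + 1)
    (hp : SolvesLegendre x p) (h0 : p 0 = 1) (h1 : p 1 = x) (n : ℕ) :
    centralCoeff n * l ^ n / 2 ≤ p n ∧ p n ≤ 2 * (centralCoeff n * l ^ n) := by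
  have hpos : ∀ n, 0 < centralCoeff n * l ^ n := fun n =>
    mul_pos (centralCoeff_pos n) (pow_pos hl0 n)
  have h := ratio_bounds (q := (l ^ 2)⁻¹) (by positivity)
    (by rw [one_div]; exact inv_anti₀ (by norm_num) hl)
    (r := fun n => p n / (centralCoeff n * l ^ n)) ?_ ?_ ?_ n
  · rw [le_div_iff₀ (hpos n), div_le_iff₀ (hpos n)] at h
    exact ⟨by linarith [h.1], h.2⟩
  · simp [h0, centralCoeff]
  · have : centralCoeff 1 = 1 / 2 := by norm_num [centralCoeff, Nat.centralBinom]
    simp only [h1, this]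
    field_simp
    linear_combination hlx
  · intro n
    have c0 := succ_mul_centralCoeff_succ n
    have c1 := succ_mul_centralCoeff_succ (n + 1)
    have hc := centralCoeff_pos n
    have e1 : centralCoeff (n + 1) = (2 * n + 1) * centralCoeff n / (2 * (n + 1)) := by
      rw [eq_div_iff (by positivity)]
      linear_combination c0
    have e2 : centralCoeff (n + 2)
        = (2 * n + 3) * ((2 * n + 1) * centralCoeff n / (2 * (n + 1))) / (2 * (n + 2)) := by
      push_cast at c1
      rw [← e1, eq_div_iff (by positivity)]
      linear_combination c1
    have e3 : p (n + 2) = ((2 * n + 3) * x * p (n + 1) - (n + 1) * p n) / (n + 2) := by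
      rw [eq_div_iff (by positivity)]
      linear_combination hp n
    have e4 : x = (l ^ 2 + 1) / (2 * l) := by
      rw [eq_div_iff (by positivity)]
      linear_combination hlx
    simp only [e1, e2, e3, e4]
    field_simp
    ring

end

/-! ### Rate of decay of the quotient `Q / P` -/

/-- A null sequence whose differences are comparable to `q ^ n` is itself comparable to `q ^ n`. -/
lemma bounds_of_sub_succ {e : ℕ → ℝ} {c C q : ℝ} (hc : 0 ≤ c) (hq0 : 0 ≤ q) (hq1 : q < 1)
    (he : Tendsto e atTop (𝓝 0)) (hl : ∀ n, c * q ^ n ≤ e n - e (n + 1))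
    (hu : ∀ n, e n - e (n + 1) ≤ C * q ^ n) (n : ℕ) :
    c * q ^ n ≤ e n ∧ e n ≤ C / (1 - q) * q ^ n := by
  constructor
  · have hanti : Antitone e := antitone_nat_of_succ_le fun n => by
      linarith [hl n, mul_nonneg hc (pow_nonneg hq0 n)]
    linarith [hl n, hanti.le_of_tendsto he (n + 1)]
  · have hmono : Monotone fun n => e n - C / (1 - q) * q ^ n := monotone_nat_of_le_succ fun n => by
      have : C / (1 - q) * q ^ n - C / (1 - q) * q ^ (n + 1) = C * q ^ n := by
        have : 1 - q ≠ 0 := by linarith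
        rw [pow_succ]
        field_simp
      linarith [hu n]
    have hlim : Tendsto (fun n => e n - C / (1 - q) * q ^ n) atTop (𝓝 0) := by
      simpa using he.sub ((tendsto_pow_atTop_nhds_zero_of_lt_one hq0 hq1).const_mul (C / (1 - q)))
    linarith [hmono.ge_of_tendsto hlim n]

section

variable {x l : ℝ}

lemma tendsto_legendreQ_div (hx : 5 ≤ x) :
    Tendsto (fun n => legendreQ x n / (legendre n).eval x) atTop (𝓝 0) := by
  have hp : ∀ n, (4 : ℝ) ^ n ≤ (legendre n).eval x := by
    intro n
    cases n with
    | zero => simp [legendre]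
    | succ n =>
      have := (solvesLegendre_eval_legendre x).mul_pow_le hx (by simp [legendre])
        (by simp only [legendre, Polynomial.eval_one, Polynomial.eval_X]; linarith) n
      refine le_trans ?_ this
      simp only [legendre, Polynomial.eval_X]
      rw [pow_succ, mul_comm]
      gcongr
      linarith
  have hlim : Tendsto (fun n : ℕ => 2 / (x - 1) * (3 / 4 : ℝ) ^ n) atTop (𝓝 0) := by
    simpa using (tendsto_pow_atTop_nhds_zero_of_lt_one (r := (3 / 4 : ℝ)) (by norm_num)
      (by norm_num)).const_mul (2 / (x - 1))
  refine squeeze_zero_norm (fun n => ?_) hlim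
  have h4 : (0 : ℝ) < 4 ^ n := by positivity
  rw [Real.norm_eq_abs, abs_div, abs_of_pos (h4.trans_le (hp n)), div_pow, mul_div_assoc']
  have h := abs_legendreQ_le (by linarith : 1 < x) n
  exact div_le_div₀ ((abs_nonneg _).trans h) h h4 (hp n)

lemma legendreQ_div_bounds (hx : 5 ≤ x) (hl0 : 0 < l) (hl : 2 ≤ l ^ 2)
    (hlx : 2 * x * l = l ^ 2 + 1) (n : ℕ) :
    1 / l * ((l ^ 2)⁻¹) ^ n ≤ legendreQ x n / (legendre n).eval x ∧
      legendreQ x n / (legendre n).eval x ≤ 32 / l / (1 - (l ^ 2)⁻¹) * ((l ^ 2)⁻¹) ^ n := by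
  have hb := (solvesLegendre_eval_legendre x).bounds hl0 hl hlx (by simp [legendre])
    (by simp [legendre])
  have hcpos : ∀ n, 0 < centralCoeff n * l ^ n := fun n =>
    mul_pos (centralCoeff_pos n) (pow_pos hl0 n)
  have hpos : ∀ n, 0 < (legendre n).eval x := fun n =>
    (half_pos (hcpos n)).trans_le (hb n).1
  have hdiff : ∀ n : ℕ, legendreQ x n / (legendre n).eval x
      - legendreQ x (n + 1) / (legendre (n + 1)).eval x
      = 2 / ((n + 1) * ((legendre n).eval x * (legendre (n + 1)).eval x)) := by
    intro n
    have hc := (solvesLegendre_eval_legendre x).casoratian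
      (solvesLegendre_legendreQ (by linarith : 1 < x)) n
    rw [legendreQ_one (by linarith)] at hc
    simp only [legendre, Polynomial.eval_one, Polynomial.eval_X] at hc
    have h0 := (hpos n).ne'
    have h1 := (hpos (n + 1)).ne'
    rw [div_sub_div _ _ h0 h1, div_eq_div_iff (by positivity) (by positivity)]
    linear_combination (Polynomial.eval x (legendre n) * Polynomial.eval x (legendre (n + 1))) * hc
  have hden : ∀ n : ℕ, l * (l ^ 2) ^ n / 16
        ≤ (n + 1) * ((legendre n).eval x * (legendre (n + 1)).eval x) ∧
      (n + 1) * ((legendre n).eval x * (legendre (n + 1)).eval x) ≤ 2 * (l * (l ^ 2) ^ n) := by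
    intro n
    obtain ⟨hcl, hcu⟩ := centralCoeff_mul_bounds n
    have hq : (1 : ℝ) / 4 ≤ (n + 1) / (2 * (2 * n + 1)) := by
      rw [div_le_div_iff₀ (by norm_num) (by positivity)]
      linarith
    have hL : 0 < l * (l ^ 2) ^ n := by positivity
    have hexp : (n + 1) * ((centralCoeff n * l ^ n) * (centralCoeff (n + 1) * l ^ (n + 1)))
        = (n + 1) * (centralCoeff n * centralCoeff (n + 1)) * (l * (l ^ 2) ^ n) := by
      rw [← pow_mul]
      ring
    have e1 := mul_le_mul (hb n).1 (hb (n + 1)).1 (half_pos (hcpos _)).le (hpos n).le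
    have e2 := mul_le_mul (hb n).2 (hb (n + 1)).2 (hpos _).le
      (mul_pos two_pos (hcpos n)).le
    have hn : (0 : ℝ) ≤ n + 1 := by positivity
    have e1' := mul_le_mul_of_nonneg_left e1 hn
    have e2' := mul_le_mul_of_nonneg_left e2 hn
    have e3 := mul_le_mul_of_nonneg_right (hq.trans hcl) hL.le
    have e4 := mul_le_mul_of_nonneg_right hcu hL.le
    constructor <;> linarith
  have hlt : (l ^ 2)⁻¹ < 1 := inv_lt_one_of_one_lt₀ (by linarith)
  refine bounds_of_sub_succ (by positivity) (by positivity) hlt (tendsto_legendreQ_div hx)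
    (fun n => ?_) (fun n => ?_) n
  · have hP : 0 < (n + 1) * ((legendre n).eval x * (legendre (n + 1)).eval x) :=
      mul_pos (by positivity) (mul_pos (hpos n) (hpos (n + 1)))
    rw [hdiff, inv_pow, one_div, ← mul_inv, ← one_div, div_le_div_iff₀ (by positivity) hP]
    linarith [(hden n).2]
  · have hP : 0 < (n + 1) * ((legendre n).eval x * (legendre (n + 1)).eval x) :=
      mul_pos (by positivity) (mul_pos (hpos n) (hpos (n + 1)))
    rw [hdiff, inv_pow, div_mul_eq_mul_div, ← div_eq_mul_inv, div_div,
      div_le_div_iff₀ hP (by positivity)]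
    linarith [(hden n).1]

end

/-! ### Continuants of `K a b` -/

section

variable (a b : ℕ → ℝ)

lemma nums_K_zero : (K a b).nums 0 = 0 := rfl

lemma nums_K_one : (K a b).nums 1 = a 0 := by
  have := GenContFract.first_num_eq (g := K a b) (gp := ⟨a 0, b 0⟩) rfl
  simpa [K] using this

lemma dens_K_zero : (K a b).dens 0 = 1 := rfl

lemma dens_K_one : (K a b).dens 1 = b 0 :=
  GenContFract.first_den_eq (g := K a b) (gp := ⟨a 0, b 0⟩) rfl

lemma nums_K_add_two (n : ℕ) :
    (K a b).nums (n + 2) = b (n + 1) * (K a b).nums (n + 1) + a (n + 1) * (K a b).nums n :=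
  GenContFract.nums_recurrence (g := K a b) (gp := ⟨a (n + 1), b (n + 1)⟩) rfl rfl rfl

lemma dens_K_add_two (n : ℕ) :
    (K a b).dens (n + 2) = b (n + 1) * (K a b).dens (n + 1) + a (n + 1) * (K a b).dens n :=
  GenContFract.dens_recurrence (g := K a b) (gp := ⟨a (n + 1), b (n + 1)⟩) rfl rfl rfl

variable {a b}

/-- A solution of the recurrence of `K a b` is determined by its values `f` and `F 0` at the indices
`-1` and `0`, where the continuants `nums` and `dens` have the values `1, 0` and `0, 1`. -/
lemma eq_nums_add_dens {F : ℕ → ℝ} {f : ℝ} (h1 : F 1 = b 0 * F 0 + a 0 * f)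
    (hF : ∀ n, F (n + 2) = b (n + 1) * F (n + 1) + a (n + 1) * F n) (n : ℕ) :
    F n = f * (K a b).nums n + F 0 * (K a b).dens n := by
  induction n using Nat.twoStepInduction with
  | zero => rw [nums_K_zero, dens_K_zero]; ring
  | one => rw [nums_K_one, dens_K_one, h1]; ring
  | more n ih0 ih1 =>
    rw [nums_K_add_two, dens_K_add_two, hF]
    linear_combination b (n + 1) * ih1 + a (n + 1) * ih0

/-- The effect on the continuants of an equivalence transformation by a constant factor `c`. -/
lemma nums_dens_K_of_scaling {a' b' : ℕ → ℝ} {c : ℝ} (ha : ∀ n, a' n = c ^ 2 * a n)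
    (hb : ∀ n, b' n = c * b n) (n : ℕ) :
    (K a' b').nums n = c ^ (n + 1) * (K a b).nums n ∧
      (K a' b').dens n = c ^ n * (K a b).dens n := by
  induction n using Nat.twoStepInduction with
  | zero => exact ⟨by rw [nums_K_zero, nums_K_zero, mul_zero], by simp⟩
  | one => simp [nums_K_one, dens_K_one, ha, hb]
  | more n ih0 ih1 =>
    simp only [nums_K_add_two, dens_K_add_two, ih0.1, ih0.2, ih1.1, ih1.2, ha, hb]
    constructor <;> ring

end

/-! ### Even contraction of the Legendre recurrence -/

/-- The factor that turns the even part of a solution of the Legendre recurrence into a solution of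
the recurrence of `K₁`. -/
noncomputable def evenScale : ℕ → ℝ
  | 0 => 1
  | k + 1 => (2 * k + 3) * (k + 2) * (4 * k + 3) * evenScale k

lemma evenScale_pos (k : ℕ) : 0 < evenScale k := by
  induction k with
  | zero => simp [evenScale]
  | succ k ih => rw [evenScale]; positivity

/-- Elimination of `y (n + 1)` and `y (n + 3)` from three consecutive instances of the recurrence. -/
lemma SolvesLegendre.even_contraction {x : ℝ} {y : ℕ → ℝ} (hy : SolvesLegendre x y) (n : ℕ) :
    ((n : ℝ) + 3) * (n + 4) * (2 * n + 3) * y (n + 4)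
      = (2 * n + 5) * ((2 * n + 3) * (2 * n + 7) * x ^ 2 - (2 * n ^ 2 + 10 * n + 11)) * y (n + 2)
        - (2 * n + 7) * (n + 2) * (n + 1) * y n := by
  have h0 := hy n
  have h1 := hy (n + 1)
  have h2 := hy (n + 2)
  push_cast at h1 h2
  linear_combination (n + 3) * (2 * n + 3) * h2 + (2 * n + 7) * (2 * n + 3) * x * h1
    + (2 * n + 7) * (n + 2) * h0

lemma eta_sq : eta ^ 2 = 6 * eta - 1 := by
  have : √2 ^ 2 = (2 : ℝ) := Real.sq_sqrt (by norm_num)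
  rw [eta]
  linear_combination 4 * this

lemma five_le_eta : 5 ≤ eta := by
  have : 1 ≤ √2 := Real.one_le_sqrt.2 (by norm_num)
  rw [eta]
  linarith

lemma one_lt_eta : 1 < eta := by linarith [five_le_eta]

/-- The index `-1` of the continuants corresponds to `y 0`; the recurrence of `evenScale`, extended to
`k = -1`, gives it the scaling factor `-1`. -/
lemma evenScale_mul_eq {y : ℕ → ℝ} (hy : SolvesLegendre eta y) (n : ℕ) :
    evenScale n * y (2 * n + 2) = -y 0 * K₁.nums n + y 2 * K₁.dens n := by
  have h := eq_nums_add_dens (a := S) (b := fun k => T k + eta * U k)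
    (F := fun n => evenScale n * y (2 * n + 2)) (f := -y 0) ?_ ?_ n
  · rw [h, evenScale, one_mul, K₁]
  · have h0 := hy.even_contraction 0
    rw [eta_sq] at h0
    norm_num [evenScale, S, T, U] at h0 ⊢
    linear_combination h0 / 2
  · intro n
    have h0 := hy.even_contraction (2 * n + 2)
    rw [eta_sq] at h0
    push_cast at h0
    simp only [evenScale, S, T, U]
    push_cast
    have e1 : 2 * (n + 2) + 2 = 2 * n + 2 + 4 := by ring
    have e2 : 2 * (n + 1) + 2 = 2 * n + 2 + 2 := by ring
    rw [e1, e2]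
    linear_combination (2 * (n : ℝ) + 3) * (n + 2) * (4 * n + 3) * evenScale n / 2 * h0

/-- The solution of the Legendre recurrence with initial values `0, 2` (for `1 < x`): a multiple of the
associated Legendre polynomial of degree `n - 1`. -/
noncomputable def legendreW (x : ℝ) (n : ℕ) : ℝ :=
  legendreQ x 0 * (legendre n).eval x - legendreQ x n

lemma solvesLegendre_legendreW {x : ℝ} (hx : 1 < x) : SolvesLegendre x (legendreW x) := by
  have h := (solvesLegendre_eval_legendre x).linear_comb (solvesLegendre_legendreQ hx)
    (legendreQ x 0) (-1)
  refine fun n => ?_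
  simp only [legendreW]
  linear_combination h n

lemma legendreW_zero (x : ℝ) : legendreW x 0 = 0 := by
  simp [legendreW, legendre]

lemma legendreW_one {x : ℝ} (hx : 1 < x) : legendreW x 1 = 2 := by
  rw [legendreW, legendreQ_one hx]
  simp only [legendre, Polynomial.eval_X]
  ring

lemma legendreW_succ_pos (n : ℕ) : 0 < legendreW eta (n + 1) := by
  have h := (solvesLegendre_legendreW one_lt_eta).mul_pow_le five_le_eta
    (legendreW_zero _).ge (by rw [legendreW_zero, legendreW_one one_lt_eta]; norm_num) n
  rw [legendreW_one one_lt_eta] at h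
  exact lt_of_lt_of_le (by positivity) h

lemma eval_legendre_succ_pos (n : ℕ) : 0 < (legendre (n + 1)).eval eta := by
  have h1 : (legendre 1).eval eta = eta := by simp [legendre]
  have h0 : (legendre 0).eval eta = 1 := by simp [legendre]
  have h := (solvesLegendre_eval_legendre eta).mul_pow_le five_le_eta
    (by simp only [h0]; norm_num) (by simp only [h0, h1]; exact one_lt_eta.le) n
  simp only [h1] at h
  exact lt_of_lt_of_le (mul_pos (by linarith [one_lt_eta]) (by positivity)) h

lemma evenScale_mul_legendreW (n : ℕ) :
    2 * (evenScale n * legendreW eta (2 * n + 2)) = 6 * eta * K₁.dens n := by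
  have h := (solvesLegendre_legendreW one_lt_eta) 0
  rw [legendreW_zero, zero_add, legendreW_one one_lt_eta] at h
  rw [evenScale_mul_eq (solvesLegendre_legendreW one_lt_eta), legendreW_zero]
  push_cast at h
  linear_combination K₁.dens n * h

lemma evenScale_mul_legendre (n : ℕ) :
    evenScale n * (legendre (2 * n + 2)).eval eta = (-2 + 9 * eta) * K₁.dens n - K₁.nums n := by
  have h := (solvesLegendre_eval_legendre eta) 0
  rw [evenScale_mul_eq (y := fun n => (legendre n).eval eta) (solvesLegendre_eval_legendre eta)]
  simp only [legendre, Polynomial.eval_X, Polynomial.eval_one] at h ⊢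
  push_cast at h
  simp only [Polynomial.eval_sub, Polynomial.eval_mul, Polynomial.eval_C, Polynomial.eval_X,
    Polynomial.eval_one, Nat.cast_zero]
  linear_combination (3 / 2 * K₁.dens n) * eta_sq

/-! ### Approximants as quotients of Legendre functions -/

lemma dens_K₁_pos (n : ℕ) : 0 < K₁.dens n := by
  have h := evenScale_mul_legendreW n
  have h1 : 0 < 6 * eta * K₁.dens n :=
    h ▸ mul_pos two_pos (mul_pos (evenScale_pos n) (legendreW_succ_pos _))
  exact (pos_iff_pos_of_mul_pos h1).1 (by linarith [one_lt_eta])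

lemma outer_den₁_eq (n : ℕ) :
    -2 + 9 * eta - K₁.convs n = evenScale n * (legendre (2 * n + 2)).eval eta / K₁.dens n := by
  have hd := (dens_K₁_pos n).ne'
  rw [GenContFract.conv_eq_num_div_den, evenScale_mul_legendre]
  field_simp

lemma outer_den₁_pos (n : ℕ) : 0 < -2 + 9 * eta - K₁.convs n := by
  rw [outer_den₁_eq]
  exact div_pos (mul_pos (evenScale_pos n) (eval_legendre_succ_pos _)) (dens_K₁_pos n)

/-! ### The error of the approximants -/

lemma log_two_eq : Real.log 2 = 2 * legendreQ eta 0 := by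
  have h2 : √2 ^ 2 = (2 : ℝ) := Real.sq_sqrt (by norm_num)
  have h : (eta + 1) / (eta - 1) = √2 := by
    rw [div_eq_iff (by linarith [one_lt_eta]), eta]
    linear_combination (-2) * h2
  rw [legendreQ_zero one_lt_eta, h, Real.log_sqrt (by norm_num)]
  ring

lemma log_two_sub_approx₁ (n : ℕ) : Real.log 2 - approx₁ n
    = 2 * (legendreQ eta (2 * n + 2) / (legendre (2 * n + 2)).eval eta) := by
  have hs := (evenScale_pos n).ne'
  have hp := (eval_legendre_succ_pos (2 * n + 1)).ne'
  have happrox : approx₁ n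
      = 2 * (legendreW eta (2 * n + 2) / (legendre (2 * n + 2)).eval eta) := by
    rw [approx₁, outer_den₁_eq, div_div_eq_mul_div, ← evenScale_mul_legendreW]
    field_simp
  rw [happrox, log_two_eq, legendreW]
  field_simp
  ring

/-- As `66 + 48 * √2 = 4 * eta ^ 2 - 2`, this says that `rho = l ^ 2` with `2 * eta = l + l⁻¹`. -/
lemma rho_quadratic : rho ^ 2 + 1 = (66 + 48 * √2) * rho := by
  have h2 : √2 ^ 2 = (2 : ℝ) := Real.sq_sqrt (by norm_num)
  have ht : √(140 + 99 * √2) ^ 2 = 140 + 99 * √2 := Real.sq_sqrt (by positivity)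
  rw [rho]
  linear_combination 16 * ht - 576 * h2

lemma rho_bounds : 133 < rho ∧ rho < 134 := by
  have h1 : 1.414 < √2 := Real.lt_sqrt_of_sq_lt (by norm_num)
  have h2 : √2 < 1.4143 := (Real.sqrt_lt' (by norm_num)).2 (by norm_num)
  have h3 : 16.7 < √(140 + 99 * √2) := Real.lt_sqrt_of_sq_lt (by norm_num at h1 ⊢; linarith)
  have h4 : √(140 + 99 * √2) < 16.74 :=
    (Real.sqrt_lt' (by norm_num)).2 (by norm_num at h2 ⊢; linarith)
  rw [rho]
  norm_num at h1 h2 h3 h4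
  constructor <;> linarith

lemma two_mul_eta_mul_sqrt_rho : 2 * eta * √rho = √rho ^ 2 + 1 := by
  have hr : 0 ≤ rho := by linarith [rho_bounds.1]
  have hs : √rho ^ 2 = rho := Real.sq_sqrt hr
  have he : 0 < eta := by linarith [one_lt_eta]
  refine (sq_eq_sq₀ (by positivity) (by positivity)).1 ?_
  have h := eta_sq
  have hl : 4 * eta ^ 2 = 68 + 48 * √2 := by rw [h, eta]; ring
  rw [mul_pow, mul_pow, hs]
  linear_combination rho * hl - rho_quadratic

lemma error_bounds : ∃ c C : ℝ, 0 < c ∧ ∀ n : ℕ,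
    c * rho ^ (-2 * (n : ℤ)) ≤ Real.log 2 - approx₁ n ∧
      Real.log 2 - approx₁ n ≤ C * rho ^ (-2 * (n : ℤ)) := by
  obtain ⟨hr, -⟩ := rho_bounds
  have hs : √rho ^ 2 = rho := Real.sq_sqrt (by linarith)
  have hr0 : 0 < rho := by linarith
  have hb := legendreQ_div_bounds five_le_eta (Real.sqrt_pos.2 hr0) (by rw [hs]; linarith)
    two_mul_eta_mul_sqrt_rho
  rw [hs] at hb
  refine ⟨2 * (1 / √rho * rho⁻¹ ^ 2), 2 * (32 / √rho / (1 - rho⁻¹) * rho⁻¹ ^ 2), by positivity,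
    fun n => ?_⟩
  have hz : rho ^ (-2 * (n : ℤ)) = rho⁻¹ ^ (2 * n) := by
    rw [inv_pow, ← zpow_natCast, ← zpow_neg]
    push_cast
    ring_nf
  obtain ⟨h1, h2⟩ := hb (2 * n + 2)
  rw [pow_add] at h1 h2
  rw [hz, log_two_sub_approx₁]
  constructor <;> linarith

lemma isTheta_error :
    (fun n : ℕ => Real.log 2 - approx₁ n) =Θ[atTop] (fun n : ℕ => rho ^ (-2 * (n : ℤ))) := by
  obtain ⟨c, C, hc, h⟩ := error_bounds
  have hr0 : 0 < rho := by linarith [rho_bounds.1]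
  have hz : ∀ n : ℕ, 0 < rho ^ (-2 * (n : ℤ)) := fun n => zpow_pos hr0 _
  have hpos : ∀ n, 0 < Real.log 2 - approx₁ n := fun n => (mul_pos hc (hz n)).trans_le (h n).1
  constructor
  · refine IsBigO.of_bound C (Eventually.of_forall fun n => ?_)
    rw [Real.norm_of_nonneg (hpos n).le, Real.norm_of_nonneg (hz n).le]
    exact (h n).2
  · refine IsBigO.of_bound c⁻¹ (Eventually.of_forall fun n => ?_)
    rw [Real.norm_of_nonneg (hpos n).le, Real.norm_of_nonneg (hz n).le, ← div_eq_inv_mul,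
      le_div_iff₀' hc]
    exact (h n).1

lemma tendsto_approx₁ : Tendsto approx₁ atTop (𝓝 (Real.log 2)) := by
  have h := (tendsto_legendreQ_div five_le_eta).comp
    (tendsto_atTop_mono (fun n => by omega : ∀ n : ℕ, n ≤ 2 * n + 2) tendsto_id)
  have h2 := (h.const_mul 2).const_sub (Real.log 2)
  simp only [mul_zero, sub_zero] at h2
  refine h2.congr fun n => ?_
  simp only [Function.comp_apply]
  rw [← log_two_sub_approx₁]
  ring

lemma tendsto_convs_K₁ :
    Tendsto K₁.convs atTop (𝓝 (-2 + 9 * eta - 6 * eta / Real.log 2)) := by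
  have hlog : Real.log 2 ≠ 0 := (Real.log_pos one_lt_two).ne'
  have h := ((tendsto_const_nhds (x := 6 * eta)).div tendsto_approx₁ hlog).const_sub (-2 + 9 * eta)
  refine h.congr fun n => ?_
  have hD := (outer_den₁_pos n).ne'
  have he : 6 * eta ≠ 0 := by linarith [one_lt_eta]
  simp only [Pi.div_apply]
  rw [approx₁, div_div_cancel₀ he]
  ring

/-! ### The second expansion -/

lemma nums_dens_K₂ (n : ℕ) :
    K₂.nums n = 4 ^ (n + 1) * K₁.nums n ∧ K₂.dens n = 4 ^ n * K₁.dens n := by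
  refine nums_dens_K_of_scaling (fun k => ?_) (fun k => ?_) n
  · simp only [S, S']; ring
  · simp only [T, T', U, U', eta']; ring

lemma convs_K₂ (n : ℕ) : K₂.convs n = 4 * K₁.convs n := by
  have hd := (dens_K₁_pos n).ne'
  rw [GenContFract.conv_eq_num_div_den, GenContFract.conv_eq_num_div_den, (nums_dens_K₂ n).1,
    (nums_dens_K₂ n).2, pow_succ]
  field_simp

lemma approx₂_eq (n : ℕ) : approx₂ n = approx₁ n := by
  have h : 1 + 9 * eta' - K₂.convs n = 4 * (-2 + 9 * eta - K₁.convs n) := by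
    rw [convs_K₂, eta']
    ring
  have h2 : 6 + 6 * eta' = 4 * (6 * eta) := by
    rw [eta']
    ring
  rw [approx₂, h, h2, mul_div_mul_left _ _ (by norm_num), approx₁]

/-! ### Numerical value of the rate -/

lemma abs_logb_rho : |2 * Real.logb 10 rho - 4.25| < 0.005 := by
  obtain ⟨h1, h2⟩ := rho_bounds
  -- `121 / 57` and `117 / 55` are fractions of small denominator that separate `2.1225` from
  -- `logb 10 133` and `logb 10 134` from `2.1275`.
  have hl : ((121 : ℕ) : ℝ) < (57 : ℕ) * Real.logb 10 rho := by
    rw [← Real.logb_pow, Real.lt_logb_iff_rpow_lt (by norm_num) (by positivity),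
      Real.rpow_natCast]
    exact lt_trans (by norm_num) (pow_lt_pow_left₀ h1 (by norm_num) (by norm_num : 57 ≠ 0))
  have hu : (55 : ℕ) * Real.logb 10 rho < ((117 : ℕ) : ℝ) := by
    rw [← Real.logb_pow, Real.logb_lt_iff_lt_rpow (by norm_num) (by positivity),
      Real.rpow_natCast]
    exact lt_trans (pow_lt_pow_left₀ h2 (by positivity) (by norm_num : 55 ≠ 0)) (by norm_num)
  push_cast at hl hu
  rw [abs_lt]
  constructor <;> linarith

end LogTwoCF

theorem mainTheorem2 :
    -- first form: the continued fraction converges, and its value gives `ln 2`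
    (∃ L : ℝ, LogTwoCF.ConvergesTo LogTwoCF.S
        (fun k => LogTwoCF.T k + LogTwoCF.eta * LogTwoCF.U k) L ∧
      -2 + 9 * LogTwoCF.eta - L ≠ 0 ∧
      Real.log 2 = 6 * LogTwoCF.eta / (-2 + 9 * LogTwoCF.eta - L)) ∧
    -- second form
    (∃ L' : ℝ, LogTwoCF.ConvergesTo LogTwoCF.S'
        (fun k => LogTwoCF.T' k + LogTwoCF.eta' * LogTwoCF.U' k) L' ∧
      1 + 9 * LogTwoCF.eta' - L' ≠ 0 ∧
      Real.log 2 = (6 + 6 * LogTwoCF.eta') / (1 + 9 * LogTwoCF.eta' - L')) ∧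
    -- all approximants are well defined, and the two forms are equivalent
    (∀ n : ℕ, -2 + 9 * LogTwoCF.eta - LogTwoCF.K₁.convs n ≠ 0 ∧
      1 + 9 * LogTwoCF.eta' - LogTwoCF.K₂.convs n ≠ 0 ∧
      LogTwoCF.approx₂ n = LogTwoCF.approx₁ n) ∧
    -- the rate of convergence of both forms
    ((fun n : ℕ => Real.log 2 - LogTwoCF.approx₁ n) =Θ[atTop]
      (fun n : ℕ => LogTwoCF.rho ^ (-2 * (n : ℤ)))) ∧
    ((fun n : ℕ => Real.log 2 - LogTwoCF.approx₂ n) =Θ[atTop]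
      (fun n : ℕ => LogTwoCF.rho ^ (-2 * (n : ℤ)))) ∧
    -- numerically, `rho ^ (-2 n)` is about `10 ^ (-4.25 n)`
    |2 * Real.logb 10 LogTwoCF.rho - 4.25| < 0.005 := by
  have hlog : Real.log 2 ≠ 0 := (Real.log_pos one_lt_two).ne'
  have he : LogTwoCF.eta ≠ 0 := by linarith [LogTwoCF.one_lt_eta]
  have hval : 6 * LogTwoCF.eta / Real.log 2 ≠ 0 := div_ne_zero (mul_ne_zero (by norm_num) he) hlog
  have hconv₂ : Tendsto LogTwoCF.K₂.convs atTop
      (𝓝 (4 * (-2 + 9 * LogTwoCF.eta - 6 * LogTwoCF.eta / Real.log 2))) :=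
    (LogTwoCF.tendsto_convs_K₁.const_mul 4).congr fun n => (LogTwoCF.convs_K₂ n).symm
  have hL₂ : 1 + 9 * LogTwoCF.eta' - 4 * (-2 + 9 * LogTwoCF.eta - 6 * LogTwoCF.eta / Real.log 2)
      = 4 * (6 * LogTwoCF.eta / Real.log 2) := by
    rw [LogTwoCF.eta']
    ring
  refine ⟨⟨_, ⟨fun n => (LogTwoCF.dens_K₁_pos n).ne', LogTwoCF.tendsto_convs_K₁⟩, ?_, ?_⟩,
    ⟨_, ⟨fun n => ?_, hconv₂⟩, ?_, ?_⟩, fun n => ⟨(LogTwoCF.outer_den₁_pos n).ne', ?_,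
      LogTwoCF.approx₂_eq n⟩, LogTwoCF.isTheta_error, ?_, LogTwoCF.abs_logb_rho⟩
  · rwa [sub_sub_cancel]
  · rw [sub_sub_cancel, div_div_cancel₀ (mul_ne_zero (by norm_num) he)]
  · have h := (LogTwoCF.nums_dens_K₂ n).2
    have hd := LogTwoCF.dens_K₁_pos n
    rw [LogTwoCF.K₂] at h
    rw [h]
    positivity
  · rw [hL₂]
    exact mul_ne_zero (by norm_num) hval
  · rw [hL₂, LogTwoCF.eta']
    field_simp
    ring
  · have h := LogTwoCF.outer_den₁_pos n
    rw [LogTwoCF.convs_K₂, LogTwoCF.eta']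
    intro h0
    linarith
  · simpa only [LogTwoCF.approx₂_eq] using LogTwoCF.isTheta_error
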